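/- A standard operator algebra on a complex Banach space $X$ is a subalgebra of the algebra $\mathcal B(X)$ of bounded linear operators on $X$ that contains all finite rank operators (it is not assumed to be closed or to contain the identity). For $T\in\mathcal B(X)$ with spectrum $\sigma(T)$ and spectral radius $r(T)$, let $\sigma_\pi(T)=\{z\in\sigma(T):|z|=r(T)\}$ be its peripheral spectrum, and let $T^*\in\mathcal B(X^*)$, $T^*f=f\circ T$, be its adjoint on the dual space $X^*$. Theorem 2.2. Let $\mathcal A_1$ and $\mathcal A_2$ be standard operator algebras on complex Banach spaces $X_1$ and $X_2$, respectively. Let $\Phi:\mathcal A_1\to\mathcal A_2$ be a map (not assumed linear or continuous) whose range contains all operators in $\mathcal B(X_2)$ of rank at most two, let $r,s$ be nonnegative integers with $r+s\ge 1$, and put $m=r+s+1$. Then $$\sigma_\pi(B^rAB^s)=\sigma_\pi(\Phi(B)^r\Phi(A)\Phi(B)^s)\quad\text{for all }A,B\in\mathcal A_1$$ (where $B^0$ and $\Phi(B)^0$ denote the identity operator) if and only if one of the following two statements holds. (1) There exist a scalar $\lambda\in\mathbb C$ with $\lambda^m=1$ and an invertible operator $T\in\mathcal B(X_1,X_2)$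 such that $\Phi(A)=\lambda TAT^{-1}$ for all $A\in\mathcal A_1$. (2) There exist a scalar $\lambda\in\mathbb C$ with $\lambda^m=1$ and an invertible operator $T\in\mathcal B(X_1^*,X_2)$ such that $\Phi(A)=\lambda TA^*T^{-1}$ for all $A\in\mathcal A_1$. Moreover, whenever (2) holds, the spaces $X_1$ and $X_2$ are reflexive. -/

import Mathlib

namespace PeripheralPreserver

noncomputable section

/-- The peripheral spectrum of a bounded operator on `X`: the points of its spectrum (relative to
the algebra of all bounded operators on `X`) whose modulus equals the spectral radius. -/
def peripheralSpectrum {X : Type*} [NormedAddCommGroup X] [NormedSpace ℂ X]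
    (T : X →L[ℂ] X) : Set ℂ :=
  {z | z ∈ spectrum ℂ T ∧ (‖z‖₊ : ENNReal) = spectralRadius ℂ T}

/-- A standard operator algebra on `X`: a subalgebra of the bounded operators containing every
operator of finite rank. It need be neither closed nor unital. -/
def IsStandardOperatorAlgebra {X : Type*} [NormedAddCommGroup X] [NormedSpace ℂ X]
    (𝒜 : NonUnitalSubalgebra ℂ (X →L[ℂ] X)) : Prop :=
  ∀ F : X →L[ℂ] X, FiniteDimensional ℂ (LinearMap.range (F : X →ₗ[ℂ] X)) → F ∈ 𝒜

/-- The Banach space adjoint `A* f = f ∘ A` on the dual space. -/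
def banachAdjoint {X : Type*} [NormedAddCommGroup X] [NormedSpace ℂ X]
    (A : X →L[ℂ] X) : StrongDual ℂ X →L[ℂ] StrongDual ℂ X :=
  ContinuousLinearMap.precomp ℂ A

/-- Reflexivity: the canonical embedding into the bidual is onto. -/
def IsReflexiveSpace (X : Type*) [NormedAddCommGroup X] [NormedSpace ℂ X] : Prop :=
  Function.Surjective (NormedSpace.inclusionInDoubleDual ℂ X)

/-- `Φ(A) = lam T A T⁻¹` for all `A`, with `lam ^ m = 1` and `T : X₁ → X₂` bounded and invertible
(a continuous linear equivalence). -/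
def IsSpatialIso {X₁ X₂ : Type*} [NormedAddCommGroup X₁] [NormedSpace ℂ X₁]
    [NormedAddCommGroup X₂] [NormedSpace ℂ X₂]
    {𝒜₁ : NonUnitalSubalgebra ℂ (X₁ →L[ℂ] X₁)} {𝒜₂ : NonUnitalSubalgebra ℂ (X₂ →L[ℂ] X₂)}
    (m : ℕ) (Φ : 𝒜₁ → 𝒜₂) : Prop :=
  ∃ (lam : ℂ) (T : X₁ ≃L[ℂ] X₂), lam ^ m = 1 ∧
    ∀ A : 𝒜₁, (Φ A : X₂ →L[ℂ] X₂) =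
      lam • ((T : X₁ →L[ℂ] X₂) ∘L (A : X₁ →L[ℂ] X₁) ∘L (T.symm : X₂ →L[ℂ] X₁))

/-- `Φ(A) = lam T A* T⁻¹` for all `A`, with `lam ^ m = 1` and `T : X₁* → X₂` bounded and
invertible. -/
def IsSpatialAntiIso {X₁ X₂ : Type*} [NormedAddCommGroup X₁] [NormedSpace ℂ X₁]
    [NormedAddCommGroup X₂] [NormedSpace ℂ X₂]
    {𝒜₁ : NonUnitalSubalgebra ℂ (X₁ →L[ℂ] X₁)} {𝒜₂ : NonUnitalSubalgebra ℂ (X₂ →L[ℂ] X₂)}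
    (m : ℕ) (Φ : 𝒜₁ → 𝒜₂) : Prop :=
  ∃ (lam : ℂ) (T : StrongDual ℂ X₁ ≃L[ℂ] X₂), lam ^ m = 1 ∧
    ∀ A : 𝒜₁, (Φ A : X₂ →L[ℂ] X₂) =
      lam • ((T : StrongDual ℂ X₁ →L[ℂ] X₂) ∘L banachAdjoint (A : X₁ →L[ℂ] X₁) ∘L
        (T.symm : X₂ →L[ℂ] StrongDual ℂ X₁))

end

end PeripheralPreserver

namespace PeripheralPreserver

/-! ### Peripheral spectra and rank-one operators. -/

section Spectrum

variable {X : Type*} [NormedAddCommGroup X] [NormedSpace ℂ X]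

/-! Cyclic invariance of the peripheral spectrum reduces the hypothesis to the products A B^(k+1),
with k + 1 = r + s. If B = f(·)x, such a product has rank at most one and its peripheral spectrum is
the single number f(x)^k f(Ax). Take B with Φ(B) = g(·)y and g(y) = 1: then A B^(k+1) has peripheral
spectrum {g(Φ(A)y)} for every A. This forces B^(k+1) to have rank one, say f(·)x, so g(Φ(A)y) =
f(Ax) (`exists_transpose`). Such pairings determine an operator, hence Φ is linear.

On A = h(·)u the identity reads g(Φ(A)y) = f(u)h(x), a matrix in (u, h) of rank at most one,
depending bilinearly on (y, g). `bilinear_isPure_cases` classifies such families. Outside dimension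
one, either the u-factor comes from g and the h-factor from y, or the reverse. So Φ sends h(·)u to
b_h(·)Qu or to b_u(·)Qh, and `exists_equiv_of_factorization` makes Q a bounded bijection, with the
root of unity coming from A = B. Testing on rank-one idempotents then recovers Φ(A) for every A.

Conversely, conjugation preserves spectra. In the adjoint case, the rank-one operators in the range
force reflexivity, which transfers invertibility between an operator and its adjoint. -/

theorem peripheralSpectrum_congr {Y : Type*} [NormedAddCommGroup Y] [NormedSpace ℂ Y]
    {S : X →L[ℂ] X} {T : Y →L[ℂ] Y} (h : spectrum ℂ S = spectrum ℂ T) :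
    peripheralSpectrum S = peripheralSpectrum T := by
  simp only [peripheralSpectrum, spectralRadius, h]

theorem nnnorm_le_spectralRadius {S : X →L[ℂ] X} {z : ℂ} (hz : z ∈ spectrum ℂ S) :
    (‖z‖₊ : ENNReal) ≤ spectralRadius ℂ S :=
  le_iSup₂ (f := fun (k : ℂ) (_ : k ∈ spectrum ℂ S) => (‖k‖₊ : ENNReal)) z hz

/-- The nonzero points fix the spectral radius. The point 0 is peripheral only when the radius is 0,
and then nonemptiness of the other spectrum puts 0 there too. -/
theorem peripheralSpectrum_subset_of_diff_eq [Nontrivial X] [CompleteSpace X] {S T : X →L[ℂ] X}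
    (h : spectrum ℂ S \ {0} = spectrum ℂ T \ {0}) :
    peripheralSpectrum S ⊆ peripheralSpectrum T := by
  have hle : ∀ {S T : X →L[ℂ] X}, spectrum ℂ S \ {0} = spectrum ℂ T \ {0} →
      spectralRadius ℂ S ≤ spectralRadius ℂ T := by
    intro S T h
    refine iSup₂_le fun z hz => ?_
    by_cases hz0 : z = 0
    · simp [hz0]
    · have : z ∈ spectrum ℂ T \ {0} := h ▸ ⟨hz, hz0⟩
      exact nnnorm_le_spectralRadius this.1
  have hr := le_antisymm (hle h) (hle h.symm)
  rintro z ⟨hz, hzr⟩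
  refine ⟨?_, hzr.trans hr⟩
  by_cases hz0 : z = 0
  · obtain ⟨w, hw⟩ := spectrum.nonempty T
    by_cases hw0 : w = 0
    · rwa [hz0, ← hw0]
    · exfalso
      have h1 : (‖w‖₊ : ENNReal) ≤ spectralRadius ℂ T :=
        nnnorm_le_spectralRadius hw
      rw [← hr, ← hzr, hz0] at h1
      simp [hw0] at h1
  · have : z ∈ spectrum ℂ T \ {0} := h ▸ ⟨hz, hz0⟩
    exact this.1

theorem peripheralSpectrum_mul_comm [CompleteSpace X] (S T : X →L[ℂ] X) :
    peripheralSpectrum (S * T) = peripheralSpectrum (T * S) := by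
  rcases subsingleton_or_nontrivial X with hX | hX
  · rw [show S * T = T * S from ContinuousLinearMap.ext fun x => Subsingleton.elim _ _]
  · exact Set.Subset.antisymm
      (peripheralSpectrum_subset_of_diff_eq (spectrum.nonzero_mul_comm S T))
      (peripheralSpectrum_subset_of_diff_eq (spectrum.nonzero_mul_comm T S))

theorem peripheralSpectrum_pow_mul_mul_pow [CompleteSpace X] (A B : X →L[ℂ] X) (r s : ℕ) :
    peripheralSpectrum (B ^ r * A * B ^ s) = peripheralSpectrum (A * B ^ (r + s)) := by
  rw [mul_assoc, peripheralSpectrum_mul_comm, mul_assoc, ← pow_add, add_comm]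

theorem mem_spectrum_of_apply_eq_smul {S : X →L[ℂ] X} {z : ℂ} {x : X} (hx : x ≠ 0)
    (h : S x = z • x) : z ∈ spectrum ℂ S := by
  rw [spectrum.mem_iff]
  rintro ⟨u, hu⟩
  apply hx
  have h1 : (u : X →L[ℂ] X) x = 0 := by
    rw [hu]; simp [Algebra.algebraMap_eq_smul_one, h]
  calc x = ((↑u⁻¹ * ↑u : X →L[ℂ] X)) x := by simp
    _ = 0 := by rw [mul_apply_eq_comp, h1, map_zero]

/-- The peripheral spectrum of the operator `f(·) x` of rank at most one. -/
theorem peripheralSpectrum_smulRight [Nontrivial X] [CompleteSpace X] (f : StrongDual ℂ X)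
    (x : X) : peripheralSpectrum (f.smulRight x) = {f x} := by
  set F : X →L[ℂ] X := f.smulRight x with hF
  have hsub : ∀ z ∈ spectrum ℂ F, z = 0 ∨ z = f x := by
    intro z hz
    by_contra! hc
    obtain ⟨hz0, hz1⟩ := hc
    rw [spectrum.mem_iff] at hz
    have hz1' : z - f x ≠ 0 := sub_ne_zero.2 hz1
    apply hz
    -- The resolvent of a rank-one operator, from F² = f(x)F.
    refine isUnit_iff_exists.2 ⟨z⁻¹ • (1 + (z - f x)⁻¹ • F), ?_, ?_⟩
    · ext v
      simp only [hF, Algebra.algebraMap_eq_smul_one, mul_apply_eq_comp,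
        sub_apply, smul_apply,
        add_apply, one_apply_eq_self, map_smul, map_add,
        ContinuousLinearMap.smulRight_apply]
      match_scalars <;> field_simp
      ring
    · ext v
      simp only [hF, Algebra.algebraMap_eq_smul_one, mul_apply_eq_comp,
        sub_apply, smul_apply,
        add_apply, one_apply_eq_self, map_smul, map_sub,
        ContinuousLinearMap.smulRight_apply]
      match_scalars <;> field_simp
      ring
  have hmem : f x ∈ spectrum ℂ F := by
    by_cases hfx : f x = 0
    · obtain ⟨z, hz⟩ := spectrum.nonempty F
      have : z = f x := by rcases hsub z hz with h | h <;> simp [h, hfx]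
      rwa [← this]
    · refine mem_spectrum_of_apply_eq_smul (x := x) ?_ (by simp [hF])
      rintro rfl
      simp at hfx
  have hr : spectralRadius ℂ F = ‖f x‖₊ := by
    refine le_antisymm (iSup₂_le fun z hz => ?_)
      (nnnorm_le_spectralRadius hmem)
    rcases hsub z hz with h | h <;> simp [h]
  ext z
  simp only [peripheralSpectrum, Set.mem_ofPred_eq, hr, Set.mem_singleton_iff]
  constructor
  · rintro ⟨hz, hzr⟩
    rcases hsub z hz with h | h
    · subst h
      have : f x = 0 := by simpa using hzr.symm
      exact this.symm
    · exact h
  · rintro rfl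
    exact ⟨hmem, rfl⟩

/-- Two independent vectors are separated by a functional vanishing at the first. -/
theorem exists_dual_eq_zero_eq_one {v w : X} (h : ∀ t : ℂ, w ≠ t • v) :
    ∃ f : StrongDual ℂ X, f v = 0 ∧ f w = 1 := by
  by_cases hv : v = 0
  · obtain ⟨f, hf⟩ := SeparatingDual.exists_eq_one (R := ℂ) (x := w) (by simpa using h 0)
    exact ⟨f, by simp [hv], hf⟩
  · obtain ⟨g, hg⟩ := SeparatingDual.exists_eq_one (R := ℂ) hv
    obtain ⟨g', hg'⟩ := SeparatingDual.exists_eq_one (R := ℂ) (sub_ne_zero.2 (h (g w)))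
    refine ⟨g' - g' v • g, by simp [hg], ?_⟩
    simp only [map_sub, map_smul, smul_eq_mul] at hg'
    simp only [sub_apply, smul_apply, smul_eq_mul]
    linear_combination hg'

/-- If `S³ = S` and both `1` and `-1` are eigenvalues, both are peripheral. -/
theorem one_neg_one_mem_peripheralSpectrum {S : X →L[ℂ] X} (hS : S ^ 3 = S) {v w : X}
    (hv : v ≠ 0) (hw : w ≠ 0) (hSv : S v = v) (hSw : S w = -w) :
    (1 : ℂ) ∈ peripheralSpectrum S ∧ (-1 : ℂ) ∈ peripheralSpectrum S := by
  have : Nontrivial X := ⟨⟨v, 0, hv⟩⟩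
  have h1 : (1 : ℂ) ∈ spectrum ℂ S := mem_spectrum_of_apply_eq_smul hv (by simpa using hSv)
  have h2 : (-1 : ℂ) ∈ spectrum ℂ S := mem_spectrum_of_apply_eq_smul hw (by simpa using hSw)
  have hr : spectralRadius ℂ S = 1 := by
    refine le_antisymm (iSup₂_le fun z hz => ?_) ?_
    · have h3 := spectrum.subset_polynomial_aeval S (Polynomial.X ^ 3 - Polynomial.X)
        ⟨z, hz, rfl⟩
      simp only [map_sub, map_pow, Polynomial.aeval_X, hS, sub_self, spectrum.zero_eq,
        Polynomial.eval_sub, Polynomial.eval_pow, Polynomial.eval_X, Set.mem_singleton_iff] at h3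
      have h4 : z * (z ^ 2 - 1) = 0 := by linear_combination h3
      rcases mul_eq_zero.1 h4 with h | h
      · simp [h]
      · rcases mul_self_eq_one_iff.1 ((sq z).symm.trans (sub_eq_zero.1 h)) with h | h <;> simp [h]
    · simpa using nnnorm_le_spectralRadius h1
  exact ⟨⟨h1, by simp [hr]⟩, ⟨h2, by simp [hr]⟩⟩

theorem rank_smulRight_le_one (f : StrongDual ℂ X) (x : X) :
    LinearMap.rank ((f.smulRight x : X →L[ℂ] X) : X →ₗ[ℂ] X) ≤ 1 := by
  rw [LinearMap.rank, rank_submodule_le_one_iff']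
  refine ⟨x, ?_⟩
  rintro _ ⟨v, rfl⟩
  exact Submodule.mem_span_singleton.2 ⟨f v, rfl⟩

theorem IsStandardOperatorAlgebra.smulRight_mem {𝒜 : NonUnitalSubalgebra ℂ (X →L[ℂ] X)}
    (h𝒜 : IsStandardOperatorAlgebra 𝒜) (f : StrongDual ℂ X) (x : X) : f.smulRight x ∈ 𝒜 := by
  apply h𝒜
  have : LinearMap.range ((f.smulRight x : X →L[ℂ] X) : X →ₗ[ℂ] X) ≤ Submodule.span ℂ {x} := by
    rintro _ ⟨v, rfl⟩
    exact Submodule.mem_span_singleton.2 ⟨f v, rfl⟩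
  exact Submodule.finiteDimensional_of_le this

/-- An operator `D` for which every `A D`, `A` in a standard operator algebra, has at most one
peripheral spectral value has rank at most one. -/
theorem exists_eq_smulRight_of_subsingleton {𝒜 : NonUnitalSubalgebra ℂ (X →L[ℂ] X)}
    (h𝒜 : IsStandardOperatorAlgebra 𝒜) (D : X →L[ℂ] X)
    (hD : ∀ A ∈ 𝒜, (peripheralSpectrum (A * D)).Subsingleton) :
    ∃ (f : StrongDual ℂ X) (x : X), D = f.smulRight x := by
  by_cases h0 : ∀ x, D x = 0
  · exact ⟨0, 0, by ext x; simp [h0]⟩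
  push Not at h0
  obtain ⟨x₁, hx₁⟩ := h0
  by_cases hc : ∀ x, ∃ t : ℂ, D x = t • D x₁
  · obtain ⟨g, hg⟩ := SeparatingDual.exists_eq_one (R := ℂ) hx₁
    refine ⟨g ∘L D, D x₁, ?_⟩
    ext x
    obtain ⟨t, ht⟩ := hc x
    simp [ht, hg]
  push Not at hc
  obtain ⟨x₂, hx₂⟩ := hc
  exfalso
  have hx₂' : ∀ t : ℂ, D x₁ ≠ t • D x₂ := by
    intro t ht
    by_cases ht0 : t = 0
    · exact hx₁ (by simp [ht, ht0])
    · exact hx₂ t⁻¹ (by rw [ht, smul_smul, inv_mul_cancel₀ ht0, one_smul])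
  obtain ⟨f₂, h21, h22⟩ := exists_dual_eq_zero_eq_one hx₂
  obtain ⟨f₁, h12, h11⟩ := exists_dual_eq_zero_eq_one hx₂'
  have hm := 𝒜.sub_mem (h𝒜.smulRight_mem f₁ x₁) (h𝒜.smulRight_mem f₂ x₂)
  have hx₁0 : x₁ ≠ 0 := by rintro rfl; simp at hx₁
  have hx₂0 : x₂ ≠ 0 := by rintro rfl; simpa using hx₂ 0
  -- Since f_i (D x_j) = δ_ij, the product fixes x₁, negates x₂ and has range in their span.
  have key := one_neg_one_mem_peripheralSpectrum
    (S := (f₁.smulRight x₁ - f₂.smulRight x₂) * D)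
    (by ext v; simp [pow_succ, h11, h12, h21, h22]) hx₁0 hx₂0 (by simp [h11, h21])
    (by simp [h12, h22])
  have := hD _ hm key.1 key.2
  norm_num at this

/-- Operators agreeing in all pairings `g (C y)` with `g y = 1` are equal. -/
theorem eq_of_forall_dual_apply_eq {C D : X →L[ℂ] X}
    (h : ∀ (y : X) (g : StrongDual ℂ X), g y = 1 → g (C y) = g (D y)) : C = D := by
  have h1 : ∀ (y : X) (g : StrongDual ℂ X), g y ≠ 0 → g (C y) = g (D y) := by
    intro y g hg
    have := h y ((g y)⁻¹ • g) (by simp [hg])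
    simpa [hg] using this
  ext y
  by_cases hy : y = 0
  · simp [hy]
  rw [SeparatingDual.eq_iff_forall_dual_eq (R := ℂ)]
  intro g
  -- A functional vanishing at y is the difference of g + g' and g', neither of which does.
  by_cases hg : g y = 0
  · obtain ⟨g', hg'⟩ := SeparatingDual.exists_eq_one (R := ℂ) hy
    have h2 := h1 y (g + g') (by simp [hg, hg'])
    have h3 := h1 y g' (by simp [hg'])
    simpa [h3] using h2
  · exact h1 y g hg

end Spectrum

/-! ### Linear and bilinear families of matrices of rank at most one. -/

section RankOneForms

variable {K V W : Type*} {α β : Type*} [Field K] [AddCommGroup V] [Module K V]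
  [AddCommGroup W] [Module K W]

/-- A matrix with entries `M i j` is pure if it is the product of a column and a row. -/
def IsPure (M : α → β → K) : Prop :=
  ∃ (a : α → K) (b : β → K), ∀ i j, M i j = a i * b j

/-- All matrices `M v` are products with one common column. -/
def HasCommonColumn {ι : Type*} (M : ι → α → β → K) : Prop :=
  ∃ a : α → K, ∀ v, ∃ b : β → K, ∀ i j, M v i j = a i * b j

/-- All matrices `M v` are products with one common row. -/
def HasCommonRow {ι : Type*} (M : ι → α → β → K) : Prop :=
  ∃ b : β → K, ∀ v, ∃ a : α → K, ∀ i j, M v i j = a i * b j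

theorem isPure_iff_minors (M : α → β → K) :
    IsPure M ↔ ∀ i i' j j', M i j * M i' j' = M i j' * M i' j := by
  constructor
  · rintro ⟨a, b, h⟩ i i' j j'
    simp only [h]; ring
  · intro h
    by_cases h0 : ∀ i j, M i j = 0
    · exact ⟨0, 0, fun i j => by simp [h0]⟩
    · push Not at h0
      obtain ⟨i₀, j₀, h0⟩ := h0
      refine ⟨fun i => M i j₀, fun j => M i₀ j / M i₀ j₀, fun i j => ?_⟩
      field_simp
      rw [h i i₀ j j₀]

/-- A 2 × 2 minor of the sum factors as a minor of (a, a') times a minor of (b, b'), so one of the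
two pairs must be proportional. -/
theorem exists_smul_of_isPure_add {a a' : α → K} {b b' : β → K} {i₀ : α} {j₀ : β}
    (ha : a i₀ ≠ 0) (hb : b j₀ ≠ 0) (h : IsPure fun i j => a i * b j + a' i * b' j) :
    (∃ t, ∀ i, a' i = t * a i) ∨ ∃ t, ∀ j, b' j = t * b j := by
  rw [isPure_iff_minors] at h
  by_contra! hc
  obtain ⟨i, hi⟩ := hc.1 (a' i₀ / a i₀)
  obtain ⟨j, hj⟩ := hc.2 (b' j₀ / b j₀)
  have hi' : a i₀ * a' i - a i * a' i₀ ≠ 0 := by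
    intro h0; apply hi; field_simp; linear_combination h0
  have hj' : b j₀ * b' j - b j * b' j₀ ≠ 0 := by
    intro h0; apply hj; field_simp; linear_combination h0
  exact mul_ne_zero hi' hj' (by linear_combination h i₀ i j₀ j)

/-- A linear space of pure matrices has a common column or a common row. -/
theorem hasCommonColumn_or_hasCommonRow (M : V →ₗ[K] α → β → K) (hM : ∀ v, IsPure (M v)) :
    HasCommonColumn (M : V → α → β → K) ∨ HasCommonRow (M : V → α → β → K) := by
  by_cases h0 : ∀ v i j, M v i j = 0
  · exact Or.inl ⟨0, fun v => ⟨0, fun i j => by simp [h0]⟩⟩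
  push Not at h0
  obtain ⟨v₀, i₀, j₀, h0⟩ := h0
  obtain ⟨a, b, hab⟩ := hM v₀
  rw [hab] at h0
  have ha := left_ne_zero_of_mul h0
  have hb := right_ne_zero_of_mul h0
  have key : ∀ v (a' : α → K) (b' : β → K), (∀ i j, M v i j = a' i * b' j) →
      (∃ t, ∀ i, a' i = t * a i) ∨ ∃ t, ∀ j, b' j = t * b j := by
    intro v a' b' h
    refine exists_smul_of_isPure_add ha hb ?_
    convert hM (v₀ + v) using 3 with i j
    simp [h, hab]
  by_cases hcol : ∀ v, ∃ b' : β → K, ∀ i j, M v i j = a i * b' j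
  · exact Or.inl ⟨a, hcol⟩
  push Not at hcol
  obtain ⟨v₁, hv₁⟩ := hcol
  obtain ⟨a₁, b₁, h₁⟩ := hM v₁
  have na : ¬ ∃ t, ∀ i, a₁ i = t * a i := by
    rintro ⟨t, ht⟩
    obtain ⟨i, j, hij⟩ := hv₁ (fun j => t * b₁ j)
    exact hij (by rw [h₁, ht]; ring)
  obtain ⟨t₁, ht₁⟩ := (key v₁ a₁ b₁ h₁).resolve_left na
  have ht₁0 : t₁ ≠ 0 := by
    rintro rfl
    obtain ⟨i, j, hij⟩ := hv₁ 0
    exact hij (by simp [h₁, ht₁])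
  have ha₁ : ∃ i₁, a₁ i₁ ≠ 0 := by
    by_contra! h
    exact na ⟨0, fun i => by simp [h]⟩
  obtain ⟨i₁, ha₁⟩ := ha₁
  refine Or.inr ⟨b, fun v => ?_⟩
  obtain ⟨a', b', h⟩ := hM v
  -- M v₁ has row b but not column a. If M v has column a, comparison with M v₁ forces its row to be
  -- proportional to b, or M v = 0.
  rcases key v a' b' h with ⟨t, ht⟩ | ⟨t, ht⟩
  · have hb₁ : b₁ j₀ ≠ 0 := by rw [ht₁]; exact mul_ne_zero ht₁0 hb
    have hp : IsPure fun i j => a₁ i * b₁ j + a' i * b' j := by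
      convert hM (v₁ + v) using 3 with i j
      simp [h, h₁]
    rcases exists_smul_of_isPure_add ha₁ hb₁ hp with ⟨s, hs⟩ | ⟨s, hs⟩
    · by_cases ht0 : t = 0
      · exact ⟨0, fun i j => by simp [h, ht, ht0]⟩
      · exfalso
        refine na ⟨t / s, fun i => ?_⟩
        have hs0 : s ≠ 0 := by
          rintro rfl
          have h1 := hs i₀
          rw [ht, zero_mul] at h1
          exact mul_ne_zero ht0 ha h1
        field_simp
        rw [mul_comm, ← hs, ht]
    · exact ⟨fun i => s * t₁ * a' i, fun i j => by rw [h, hs, ht₁]; ring⟩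
  · exact ⟨fun i => t * a' i, fun i j => by rw [h, ht]; ring⟩

/-- If v₁ allows only a common column and v₂ only a common row, purity of L (v₁ + v₂) w covers W by
two proper subspaces, which is impossible. -/
theorem forall_hasCommonColumn_or_forall_hasCommonRow (L : V →ₗ[K] W →ₗ[K] α → β → K)
    (hL : ∀ v w, IsPure (L v w)) :
    (∀ v, HasCommonColumn (L v : W → α → β → K)) ∨ ∀ v, HasCommonRow (L v : W → α → β → K) := by
  by_contra! hc
  obtain ⟨⟨v₂, h₂⟩, ⟨v₁, h₁⟩⟩ := hc
  obtain ⟨a, ha⟩ := (hasCommonColumn_or_hasCommonRow (L v₁) (hL v₁)).resolve_right h₁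
  obtain ⟨b, hb⟩ := (hasCommonColumn_or_hasCommonRow (L v₂) (hL v₂)).resolve_left h₂
  have ha0 : ∃ i, a i ≠ 0 := by
    by_contra! h0
    exact h₁ ⟨0, fun w => ⟨0, fun i j => by obtain ⟨c, hc⟩ := ha w; simp [hc, h0]⟩⟩
  have hb0 : ∃ j, b j ≠ 0 := by
    by_contra! h0
    exact h₂ ⟨0, fun w => ⟨0, fun i j => by obtain ⟨c, hc⟩ := hb w; simp [hc, h0]⟩⟩
  obtain ⟨i₀, hi₀⟩ := ha0
  obtain ⟨j₀, hj₀⟩ := hb0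
  have hcover : ∀ w, (∃ t, ∀ i j, L v₂ w i j = t * (a i * b j)) ∨
      ∃ t, ∀ i j, L v₁ w i j = t * (a i * b j) := by
    intro w
    obtain ⟨c, hc⟩ := ha w
    obtain ⟨d, hd⟩ := hb w
    have hp : IsPure fun i j => a i * c j + d i * b j := by
      convert hL (v₁ + v₂) w using 3 with i j
      simp [hc, hd]
    by_cases hc0 : ∃ j, c j ≠ 0
    · obtain ⟨j₁, hj₁⟩ := hc0
      rcases exists_smul_of_isPure_add hi₀ hj₁ hp with ⟨t, ht⟩ | ⟨t, ht⟩
      · exact Or.inl ⟨t, fun i j => by rw [hd, ht]; ring⟩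
      · have ht0 : t ≠ 0 := by
          rintro rfl
          exact hj₀ (by simp [ht])
        exact Or.inr ⟨t⁻¹, fun i j => by rw [hc, ht]; field_simp⟩
    · push Not at hc0
      exact Or.inr ⟨0, fun i j => by simp [hc, hc0]⟩
  have hn₂ : ∃ w, ¬ ∃ t, ∀ i j, L v₂ w i j = t * (a i * b j) := by
    by_contra! h
    refine h₂ ⟨a, fun w => ?_⟩
    obtain ⟨t, ht⟩ := h w
    exact ⟨fun j => t * b j, fun i j => by rw [ht]; ring⟩
  have hn₁ : ∃ w, ¬ ∃ t, ∀ i j, L v₁ w i j = t * (a i * b j) := by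
    by_contra! h
    refine h₁ ⟨b, fun w => ?_⟩
    obtain ⟨t, ht⟩ := h w
    exact ⟨fun i => t * a i, fun i j => by rw [ht]; ring⟩
  obtain ⟨w₂, hw₂⟩ := hn₂
  obtain ⟨w₁, hw₁⟩ := hn₁
  obtain ⟨t₂, ht₂⟩ := (hcover w₂).resolve_left hw₂
  obtain ⟨t₁, ht₁⟩ := (hcover w₁).resolve_right hw₁
  -- w₁ and w₂ each lie in exactly one of the two subspaces, and not in the same one, so their sum
  -- lies in neither.
  rcases hcover (w₁ + w₂) with ⟨t, ht⟩ | ⟨t, ht⟩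
  · refine hw₂ ⟨t - t₁, fun i j => ?_⟩
    have := ht i j
    simp only [map_add, Pi.add_apply, ht₁] at this
    linear_combination this
  · refine hw₁ ⟨t - t₂, fun i j => ?_⟩
    have := ht i j
    simp only [map_add, Pi.add_apply, ht₂] at this
    linear_combination this

/-- The bilinear maps all of whose values are pure matrices. -/
theorem bilinear_isPure_cases (L : V →ₗ[K] W →ₗ[K] α → β → K) (hL : ∀ v w, IsPure (L v w)) :
    (∃ (a : α → K) (c : V → W → β → K), ∀ v w i j, L v w i j = a i * c v w j) ∨
    (∃ (b : β → K) (c : V → W → α → K), ∀ v w i j, L v w i j = b j * c v w i) ∨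
    (∃ (b : V → β → K) (c : W → α → K), ∀ v w i j, L v w i j = b v j * c w i) ∨
    ∃ (a : V → α → K) (c : W → β → K), ∀ v w i j, L v w i j = a v i * c w j := by
  rcases forall_hasCommonColumn_or_forall_hasCommonRow L hL with h | h
  · let M : V →ₗ[K] α → W × β → K :=
      { toFun := fun v i p => L v p.1 i p.2
        map_add' := fun v v' => by ext; simp
        map_smul' := fun t v => by ext; simp }
    have hM : ∀ v, IsPure (M v) := fun v => by
      obtain ⟨a, ha⟩ := h v
      choose b hb using ha
      exact ⟨a, fun p => b p.1 p.2, fun i p => hb p.1 i p.2⟩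
    rcases hasCommonColumn_or_hasCommonRow M hM with ⟨a, ha⟩ | ⟨c, hc⟩
    · choose b hb using ha
      exact Or.inl ⟨a, fun v w j => b v (w, j), fun v w i j => hb v i (w, j)⟩
    · choose a ha using hc
      exact Or.inr <| Or.inr <| Or.inr ⟨a, fun w j => c (w, j), fun v w i j => ha v i (w, j)⟩
  · let M : V →ₗ[K] β → W × α → K :=
      { toFun := fun v j p => L v p.1 p.2 j
        map_add' := fun v v' => by ext; simp
        map_smul' := fun t v => by ext; simp }
    have hM : ∀ v, IsPure (M v) := fun v => by
      obtain ⟨b, hb⟩ := h v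
      choose a ha using hb
      exact ⟨b, fun p => a p.1 p.2, fun j p => (ha p.1 p.2 j).trans (mul_comm _ _)⟩
    rcases hasCommonColumn_or_hasCommonRow M hM with ⟨b, hb⟩ | ⟨c, hc⟩
    · choose a ha using hb
      exact Or.inr <| Or.inl ⟨b, fun v w i => a v (w, i), fun v w i j => ha v j (w, i)⟩
    · choose b hb using hc
      exact Or.inr <| Or.inr <| Or.inl ⟨b, fun w i => c (w, i), fun v w i j => hb v j (w, i)⟩

/-- A bilinear form vanishing where a nondegenerate one does is a multiple of it. -/
theorem exists_eq_smul_of_forall_eq_zero (p q : V →ₗ[K] W →ₗ[K] K) (hp : ∀ v, p v = 0 → v = 0)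
    (h : ∀ v w, p v w = 0 → q v w = 0) : ∃ c : K, ∀ v w, q v w = c * p v w := by
  have h1 : ∀ v, ∃ t : K, q v = t • p v := by
    intro v
    by_cases hv : p v = 0
    · exact ⟨0, by simp [hp v hv]⟩
    · obtain ⟨w₀, hw₀⟩ : ∃ w, p v w ≠ 0 := by
        by_contra! h0
        exact hv (LinearMap.ext h0)
      refine ⟨q v w₀ / p v w₀, LinearMap.ext fun w => ?_⟩
      have := h v (w - (p v w / p v w₀) • w₀) (by simp [hw₀])
      simp only [map_sub, map_smul, smul_eq_mul, LinearMap.smul_apply] at this ⊢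
      linear_combination this
  by_cases hV : ∃ v₀ : V, v₀ ≠ 0
  · obtain ⟨v₀, hv₀⟩ := hV
    obtain ⟨t₀, ht₀⟩ := h1 v₀
    refine ⟨t₀, fun v w => ?_⟩
    suffices q v = t₀ • p v by simp [this]
    obtain ⟨t, ht⟩ := h1 v
    obtain ⟨t', ht'⟩ := h1 (v + v₀)
    -- Comparing the ratios at v, v₀ and v + v₀ through the nondegenerate p: either the ratios agree
    -- or v is a multiple of v₀.
    have e : (t' - t) • v = (t₀ - t') • v₀ := by
      rw [← sub_eq_zero]
      apply hp
      ext x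
      have := LinearMap.congr_fun ht' x
      simp only [map_add, map_sub, map_smul, ht, ht₀, LinearMap.add_apply, LinearMap.sub_apply,
        LinearMap.smul_apply, smul_eq_mul, LinearMap.zero_apply] at this ⊢
      linear_combination -this
    by_cases htt : t' = t
    · rw [htt, sub_self, zero_smul, eq_comm, smul_eq_zero, sub_eq_zero] at e
      rw [ht, e.resolve_right hv₀]
    · have : v = ((t' - t)⁻¹ * (t₀ - t')) • v₀ := by
        rw [mul_smul, ← e, smul_smul, inv_mul_cancel₀ (sub_ne_zero.2 htt), one_smul]
      rw [this, map_smul, map_smul, ht₀, smul_comm]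
  · push Not at hV
    exact ⟨0, fun v w => by simp [hV v]⟩

end RankOneForms

/-! ### From a factorization to an implementing isomorphism. -/

section Spatial

/-- A bilinear map `R` into operators of the form `R e f = b(·, f) Q e` for which the trace powers
`(tr R e f) ^ m` recover a nondegenerate pairing is implemented by a bounded invertible `Q`. -/
theorem exists_equiv_of_factorization {E F Y : Type*} [NormedAddCommGroup E] [NormedSpace ℂ E]
    [CompleteSpace E] [AddCommGroup F] [Module ℂ F] [NormedAddCommGroup Y] [NormedSpace ℂ Y]
    [CompleteSpace Y] [Nontrivial Y] {m : ℕ} (hm : m ≠ 0)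
    (p : E →ₗ[ℂ] F →ₗ[ℂ] ℂ) (hp : ∀ e, p e = 0 → e = 0)
    (R : E →ₗ[ℂ] F →ₗ[ℂ] (Y →L[ℂ] Y))
    (hR : ∀ (y : Y) (g : StrongDual ℂ Y), g y = 1 → ∃ (φ : StrongDual ℂ E) (x : E),
      φ ≠ 0 ∧ x ≠ 0 ∧ ∀ e f, g (R e f y) = φ e * p x f)
    (b : Y → F → ℂ) (c : StrongDual ℂ Y → E → ℂ)
    (hbc : ∀ y g e f, g (R e f y) = b y f * c g e)
    (htr : ∀ e f (χ : StrongDual ℂ Y) (v : Y), R e f = χ.smulRight v → χ v ^ m = p e f ^ m) :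
    ∃ (Q : E ≃L[ℂ] Y) (t : ℂ), t ^ m = 1 ∧ ∀ e f e', R e f (Q e') = (t * p e' f) • Q e := by
  have exists_apply_ne : ∀ φ : StrongDual ℂ E, φ ≠ 0 → ∃ e, φ e ≠ 0 := by
    intro φ hφ
    by_contra! h
    exact hφ (ContinuousLinearMap.ext h)
  have exists_pairing_ne : ∀ x, x ≠ 0 → ∃ f, p x f ≠ 0 := by
    intro x hx
    by_contra! h
    exact hx (hp x (LinearMap.ext h))
  obtain ⟨y₀, hy₀⟩ := exists_ne (0 : Y)
  obtain ⟨g₀, hg₀⟩ := SeparatingDual.exists_eq_one (R := ℂ) hy₀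
  obtain ⟨φ₀, x₀, hφ₀, hx₀, h₀⟩ := hR y₀ g₀ hg₀
  obtain ⟨e₀, he₀⟩ := exists_apply_ne φ₀ hφ₀
  obtain ⟨f₀, hf₀⟩ := exists_pairing_ne x₀ hx₀
  have hne : b y₀ f₀ * c g₀ e₀ ≠ 0 := by
    rw [← hbc, h₀]; exact mul_ne_zero he₀ hf₀
  have hβ := left_ne_zero_of_mul hne
  have hγ := right_ne_zero_of_mul hne
  let Q₀ : E →ₗ[ℂ] Y :=
    { toFun := fun e => (b y₀ f₀)⁻¹ • R e f₀ y₀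
      map_add' := fun e e' => by simp
      map_smul' := fun s e => by simp [smul_comm s] }
  have hgQ : ∀ g e, g (Q₀ e) = c g e := by
    intro g e
    change g ((b y₀ f₀)⁻¹ • R e f₀ y₀) = _
    rw [map_smul, hbc, smul_eq_mul, inv_mul_cancel_left₀ hβ]
  have hRQ : ∀ e f y, R e f y = b y f • Q₀ e := by
    intro e f y
    rw [SeparatingDual.eq_iff_forall_dual_eq (R := ℂ)]
    intro g
    rw [hbc, map_smul, hgQ, smul_eq_mul]
  -- For suitable y and f, b y f * g (Q₀ e) is a multiple of the continuous φ e. Weak continuity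
  -- then closes the graph of Q₀.
  have hweak : ∀ g : StrongDual ℂ Y, Continuous fun e => g (Q₀ e) := by
    intro g
    by_cases hg : g = 0
    · simpa [hg] using continuous_const
    obtain ⟨y, hy⟩ : ∃ y, g y ≠ 0 := by
      by_contra! h
      exact hg (ContinuousLinearMap.ext h)
    obtain ⟨φ, x, hφ, hx, h⟩ := hR ((g y)⁻¹ • y) g (by simp [hy])
    obtain ⟨e, he⟩ := exists_apply_ne φ hφ
    obtain ⟨f, hf⟩ := exists_pairing_ne x hx
    have hb : b ((g y)⁻¹ • y) f ≠ 0 := by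
      have := mul_ne_zero he hf
      rw [← h, hbc] at this
      exact left_ne_zero_of_mul this
    have : (fun e => g (Q₀ e)) = fun e => (b ((g y)⁻¹ • y) f)⁻¹ * (φ e * p x f) := by
      ext e
      rw [← h, hbc, hgQ, inv_mul_cancel_left₀ hb]
    rw [this]
    fun_prop
  have hcont : Continuous Q₀ := by
    apply LinearMap.continuous_of_seq_closed_graph
    intro u x y hu hy
    rw [SeparatingDual.eq_iff_forall_dual_eq (R := ℂ)]
    intro g
    exact tendsto_nhds_unique ((g.continuous.tendsto y).comp hy)
      (((hweak g).tendsto x).comp hu)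
  let χ : F →ₗ[ℂ] StrongDual ℂ Y :=
    { toFun := fun f => (c g₀ e₀)⁻¹ • (g₀ ∘L R e₀ f)
      map_add' := fun f f' => by ext; simp
      map_smul' := fun s f => by ext; simp [mul_left_comm] }
  have hχ : ∀ f y, χ f y = b y f := by
    intro f y
    change (c g₀ e₀)⁻¹ * g₀ (R e₀ f y) = _
    rw [hbc]
    field_simp
  have hRχ : ∀ e f, R e f = (χ f).smulRight (Q₀ e) := by
    intro e f
    ext y
    rw [hRQ, ContinuousLinearMap.smulRight_apply, hχ]
  -- The traces of R e f. Their m-th powers agree with those of p, so q and p have the same zeros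
  -- and are proportional.
  let q : E →ₗ[ℂ] F →ₗ[ℂ] ℂ := LinearMap.mk₂ ℂ (fun e f => χ f (Q₀ e))
    (by simp) (by simp) (by simp) (by simp)
  have hq : ∀ e f, q e f ^ m = p e f ^ m := fun e f => htr e f _ _ (hRχ e f)
  obtain ⟨t, ht⟩ := exists_eq_smul_of_forall_eq_zero p q hp fun e f h => by
    have := hq e f
    rw [h, zero_pow hm] at this
    exact eq_zero_of_pow_eq_zero this
  have htm : t ^ m = 1 := by
    have := hq x₀ f₀
    rw [ht, mul_pow] at this
    exact mul_right_cancel₀ (pow_ne_zero m hf₀) (by rw [this, one_mul])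
  have ht0 : t ≠ 0 := by
    rintro rfl
    simp [hm] at htm
  have hχQ : ∀ e f, χ f (Q₀ e) = t * p e f := ht
  let Q₁ : E →L[ℂ] Y := ⟨Q₀, hcont⟩
  have hker : (Q₁ : E →ₗ[ℂ] Y).ker = ⊥ := by
    refine LinearMap.ker_eq_bot'.2 fun e he => hp e (LinearMap.ext fun f => ?_)
    have he' : Q₀ e = 0 := he
    have := hχQ e f
    rw [he', map_zero] at this
    simpa [ht0] using this.symm
  have hran : (Q₁ : E →ₗ[ℂ] Y).range = ⊤ := by
    refine LinearMap.range_eq_top.2 fun y => ?_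
    by_cases hy : y = 0
    · exact ⟨0, by simp [hy]⟩
    obtain ⟨g, hg⟩ := SeparatingDual.exists_eq_one (R := ℂ) hy
    obtain ⟨φ, x, hφ, hx, h⟩ := hR y g hg
    obtain ⟨e, he⟩ := exists_apply_ne φ hφ
    obtain ⟨f, hf⟩ := exists_pairing_ne x hx
    have hc : c g e ≠ 0 := by
      have := mul_ne_zero he hf
      rw [← h, hbc] at this
      exact right_ne_zero_of_mul this
    -- Both b y and p x are functionals of f, with b y = (φ e / c g e) p x, while b (Q₀ e') = t p
    -- e'; this scalar makes them match. A nonzero difference of the vectors would be killed by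
    -- every R e f, against `hR`.
    refine ⟨(t⁻¹ * (φ e / c g e)) • x, ?_⟩
    change Q₀ _ = y
    by_contra hne
    obtain ⟨g', hg'⟩ := SeparatingDual.exists_eq_one (R := ℂ) (sub_ne_zero.2 hne)
    obtain ⟨φ', x', hφ', hx', h'⟩ := hR _ g' hg'
    obtain ⟨e', he'⟩ := exists_apply_ne φ' hφ'
    obtain ⟨f', hf'⟩ := exists_pairing_ne x' hx'
    apply mul_ne_zero he' hf'
    rw [← h', hRχ, ContinuousLinearMap.smulRight_apply, map_sub, hχQ, hχ, map_smul p,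
      LinearMap.smul_apply, smul_eq_mul]
    have h1 : φ e * p x f' = b y f' * c g e := by rw [← h, hbc]
    have h2 : t * (t⁻¹ * (φ e / c g e) * p x f') = b y f' := by
      field_simp
      rw [h1, mul_comm]
    rw [h2, sub_self, zero_smul, map_zero]
  refine ⟨ContinuousLinearEquiv.ofBijective Q₁ hker hran, t, htm, fun e f e' => ?_⟩
  simp only [ContinuousLinearEquiv.coeFn_ofBijective]
  change R e f (Q₀ e') = (t * p e' f) • Q₀ e
  rw [hRχ, ContinuousLinearMap.smulRight_apply, hχQ]

end Spatial

/-! ### Structure of a preserver on rank-one operators. -/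

section Preserver

variable {X₁ X₂ : Type*} [NormedAddCommGroup X₁] [NormedSpace ℂ X₁] [CompleteSpace X₁]
  [NormedAddCommGroup X₂] [NormedSpace ℂ X₂] [CompleteSpace X₂]
  {𝒜₁ : NonUnitalSubalgebra ℂ (X₁ →L[ℂ] X₁)} {𝒜₂ : NonUnitalSubalgebra ℂ (X₂ →L[ℂ] X₂)}
  {Φ : 𝒜₁ → 𝒜₂} {k : ℕ}

theorem smulRight_pow_succ {X : Type*} [NormedAddCommGroup X] [NormedSpace ℂ X]
    (f : StrongDual ℂ X) (x : X) (n : ℕ) :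
    (f.smulRight x : X →L[ℂ] X) ^ (n + 1) = (f x ^ n) • f.smulRight x := by
  induction n with
  | zero => simp
  | succ n ih =>
    rw [pow_succ, ih]
    ext v
    simp only [mul_apply_eq_comp, smul_apply, ContinuousLinearMap.smulRight_apply, map_smul]
    module

theorem mul_smulRight {X : Type*} [NormedAddCommGroup X] [NormedSpace ℂ X]
    (A : X →L[ℂ] X) (f : StrongDual ℂ X) (x : X) :
    A * f.smulRight x = f.smulRight (A x) := by
  ext v
  simp

theorem peripheralSpectrum_mul_smulRight_pow {X : Type*} [NormedAddCommGroup X]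
    [NormedSpace ℂ X] [CompleteSpace X] [Nontrivial X] (A : X →L[ℂ] X) (f : StrongDual ℂ X)
    (x : X) (n : ℕ) :
    peripheralSpectrum (A * (f.smulRight x : X →L[ℂ] X) ^ (n + 1)) = {f x ^ n * f (A x)} := by
  rw [smulRight_pow_succ, mul_smul_comm, mul_smulRight]
  have : f x ^ n • (f.smulRight (A x) : X →L[ℂ] X) = f.smulRight (f x ^ n • A x) := by
    ext v
    simp only [smul_apply, ContinuousLinearMap.smulRight_apply]
    module
  rw [this, peripheralSpectrum_smulRight, map_smul, smul_eq_mul]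

/-- The operator `h(·) u`, as an element of a standard operator algebra. -/
noncomputable def IsStandardOperatorAlgebra.rankOne (h𝒜₁ : IsStandardOperatorAlgebra 𝒜₁) (u : X₁)
    (h : StrongDual ℂ X₁) : 𝒜₁ :=
  ⟨h.smulRight u, h𝒜₁.smulRight_mem h u⟩

variable [Nontrivial X₁] [Nontrivial X₂]
  (h𝒜₁ : IsStandardOperatorAlgebra 𝒜₁)
  (hp : ∀ A B : 𝒜₁, peripheralSpectrum ((A : X₁ →L[ℂ] X₁) * (B : X₁ →L[ℂ] X₁) ^ (k + 1)) =
    peripheralSpectrum ((Φ A : X₂ →L[ℂ] X₂) * (Φ B : X₂ →L[ℂ] X₂) ^ (k + 1)))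

include h𝒜₁ hp

theorem eq_zero_of_preserver_eq_zero {A : 𝒜₁} (hA : (Φ A : X₂ →L[ℂ] X₂) = 0) :
    (A : X₁ →L[ℂ] X₁) = 0 := by
  refine eq_of_forall_dual_apply_eq fun x f hf => ?_
  have h1 := hp A (h𝒜₁.rankOne x f)
  have h2 : (0 : X₂ →L[ℂ] X₂) = (0 : StrongDual ℂ X₂).smulRight 0 := by ext; simp
  rw [hA, zero_mul, h2, peripheralSpectrum_smulRight, IsStandardOperatorAlgebra.rankOne,
    peripheralSpectrum_mul_smulRight_pow, hf] at h1
  simpa using h1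

theorem preserver_trace_pow {u : X₁} {h : StrongDual ℂ X₁} {χ : StrongDual ℂ X₂} {v : X₂}
    (hv : (Φ (h𝒜₁.rankOne u h) : X₂ →L[ℂ] X₂) = χ.smulRight v) :
    χ v ^ (k + 2) = h u ^ (k + 2) := by
  have h1 := hp (h𝒜₁.rankOne u h) (h𝒜₁.rankOne u h)
  rw [hv, IsStandardOperatorAlgebra.rankOne, peripheralSpectrum_mul_smulRight_pow,
    peripheralSpectrum_mul_smulRight_pow] at h1
  have h2 := Set.singleton_injective h1
  simp only [ContinuousLinearMap.smulRight_apply, map_smul, smul_eq_mul] at h2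
  linear_combination -h2

/-- Recovering `A` from `Φ A` once `Φ` is known on rank-one idempotents. -/
theorem apply_eq_of_preserver_rankOne {u : X₁} {h : StrongDual ℂ X₁} (hu : h u = 1)
    {χ : StrongDual ℂ X₂} {v : X₂}
    (hv : (Φ (h𝒜₁.rankOne u h) : X₂ →L[ℂ] X₂) = χ.smulRight v) (A : 𝒜₁) :
    h ((A : X₁ →L[ℂ] X₁) u) = χ v ^ k * χ ((Φ A : X₂ →L[ℂ] X₂) v) := by
  have h1 := hp A (h𝒜₁.rankOne u h)
  rw [hv, IsStandardOperatorAlgebra.rankOne, peripheralSpectrum_mul_smulRight_pow,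
    peripheralSpectrum_mul_smulRight_pow, hu, one_pow, one_mul] at h1
  exact Set.singleton_injective h1

variable (hΦ : ∀ (g : StrongDual ℂ X₂) (y : X₂), ∃ A : 𝒜₁, (Φ A : X₂ →L[ℂ] X₂) = g.smulRight y)

include hΦ

/-- Every functional `A ↦ g (Φ A y)` with `g y = 1` is of the form `A ↦ f (A x)`. -/
theorem exists_transpose (y : X₂) (g : StrongDual ℂ X₂) (hg : g y = 1) :
    ∃ (f : StrongDual ℂ X₁) (x : X₁), f ≠ 0 ∧ x ≠ 0 ∧
      ∀ A : 𝒜₁, g ((Φ A : X₂ →L[ℂ] X₂) y) = f ((A : X₁ →L[ℂ] X₁) x) := by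
  obtain ⟨B, hB⟩ := hΦ g y
  have h1 : ∀ A : 𝒜₁, peripheralSpectrum ((A : X₁ →L[ℂ] X₁) * (B : X₁ →L[ℂ] X₁) ^ (k + 1)) =
      {g ((Φ A : X₂ →L[ℂ] X₂) y)} := by
    intro A
    rw [hp, hB, peripheralSpectrum_mul_smulRight_pow, hg, one_pow, one_mul]
  obtain ⟨f, x, hfx⟩ := exists_eq_smulRight_of_subsingleton h𝒜₁ ((B : X₁ →L[ℂ] X₁) ^ (k + 1))
    (fun A hA => by rw [h1 ⟨A, hA⟩]; exact Set.subsingleton_singleton)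
  have h2 : ∀ A : 𝒜₁, g ((Φ A : X₂ →L[ℂ] X₂) y) = f ((A : X₁ →L[ℂ] X₁) x) := by
    intro A
    have := h1 A
    rw [hfx, mul_smulRight, peripheralSpectrum_smulRight] at this
    exact (Set.singleton_injective this).symm
  -- Evaluating at B itself gives f (B x) = 1, so neither f nor x vanishes.
  have h3 := h2 B
  rw [hB, ContinuousLinearMap.smulRight_apply, hg, one_smul, hg] at h3
  refine ⟨f, x, ?_, ?_, h2⟩
  · rintro rfl
    simp at h3
  · rintro rfl
    simp at h3

theorem preserver_add (A B : 𝒜₁) : (Φ (A + B) : X₂ →L[ℂ] X₂) = Φ A + Φ B := by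
  refine eq_of_forall_dual_apply_eq fun y g hg => ?_
  obtain ⟨f, x, -, -, h⟩ := exists_transpose h𝒜₁ hp hΦ y g hg
  simp [h]

theorem preserver_smul (t : ℂ) (A : 𝒜₁) : (Φ (t • A) : X₂ →L[ℂ] X₂) = t • Φ A := by
  refine eq_of_forall_dual_apply_eq fun y g hg => ?_
  obtain ⟨f, x, -, -, h⟩ := exists_transpose h𝒜₁ hp hΦ y g hg
  simp [h]

/-- The matrix of `Φ` on rank-one operators is pure for each pair `(y, g)`. -/
theorem isPure_preserver (y : X₂) (g : StrongDual ℂ X₂) :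
    IsPure fun (u : X₁) (h : StrongDual ℂ X₁) =>
      g ((Φ (h𝒜₁.rankOne u h) : X₂ →L[ℂ] X₂) y) := by
  by_cases hy : y = 0
  · exact ⟨0, 0, fun i j => by simp [hy]⟩
  have h1 : ∀ g : StrongDual ℂ X₂, g y ≠ 0 → IsPure fun (u : X₁) (h : StrongDual ℂ X₁) =>
      g ((Φ (h𝒜₁.rankOne u h) : X₂ →L[ℂ] X₂) y) := by
    intro g hg
    obtain ⟨f, x, -, -, h⟩ := exists_transpose h𝒜₁ hp hΦ y ((g y)⁻¹ • g) (by simp [hg])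
    refine ⟨fun u => g y * f u, fun h => h x, fun u j => ?_⟩
    have := h (h𝒜₁.rankOne u j)
    simp only [smul_apply, IsStandardOperatorAlgebra.rankOne, smul_eq_mul,
      ContinuousLinearMap.smulRight_apply, map_smul] at this
    rw [inv_mul_eq_iff_eq_mul₀ hg] at this
    exact this.trans (by ring)
  by_cases hg : g y = 0
  · obtain ⟨g', hg'⟩ := SeparatingDual.exists_eq_one (R := ℂ) hy
    rw [isPure_iff_minors]
    intro i i' j j'
    -- Each minor at g + t g' is a polynomial of degree at most two in t. Its vanishing at 1, -1, 2
    -- gives its vanishing at 0, with Lagrange weights 1, 1/3, -1/3.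
    have h2 : ∀ t : ℂ, t ≠ 0 → _ := fun t ht =>
      (isPure_iff_minors _).1 (h1 (g + t • g') (by simp [hg, hg', ht])) i i' j j'
    have e1 := h2 1 one_ne_zero
    have e2 := h2 (-1) (by norm_num)
    have e3 := h2 2 (by norm_num)
    simp only [add_apply, smul_apply, smul_eq_mul] at e1 e2 e3
    linear_combination e1 + (1 / 3) * e2 - (1 / 3) * e3
  · exact h1 g hg

/-- On a one-dimensional space the matrix of `Φ` factors. -/
theorem exists_factorization_of_dim_one (e : X₁) (f : StrongDual ℂ X₁)
    (hf : ∀ u, u = f u • e) :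
    ∃ (b : X₂ → StrongDual ℂ X₁ → ℂ) (c : StrongDual ℂ X₂ → X₁ → ℂ), ∀ y g u h,
      g ((Φ (h𝒜₁.rankOne u h) : X₂ →L[ℂ] X₂) y) = b y h * c g u := by
  obtain ⟨y₁, hy₁⟩ := exists_ne (0 : X₂)
  obtain ⟨g₁, hg₁⟩ := SeparatingDual.exists_eq_one (R := ℂ) hy₁
  obtain ⟨A, hA⟩ := hΦ g₁ y₁
  have hscal : ∀ B : 𝒜₁, B = f ((B : X₁ →L[ℂ] X₁) e) • h𝒜₁.rankOne e f := by
    intro B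
    ext v
    change (B : X₁ →L[ℂ] X₁) v = f ((B : X₁ →L[ℂ] X₁) e) • f v • e
    rw [smul_comm, ← hf, ← map_smul, ← hf]
  set P := h𝒜₁.rankOne e f
  have hAP := hscal A
  have hA0 : f ((A : X₁ →L[ℂ] X₁) e) ≠ 0 := by
    intro h0
    rw [hAP, h0, preserver_smul h𝒜₁ hp hΦ, zero_smul] at hA
    have := congrArg (fun C : X₂ →L[ℂ] X₂ => g₁ (C y₁)) hA
    simp [hg₁] at this
  have hP : (Φ P : X₂ →L[ℂ] X₂) = (f ((A : X₁ →L[ℂ] X₁) e))⁻¹ • g₁.smulRight y₁ := by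
    rw [← hA]
    nth_rw 2 [hAP]
    rw [preserver_smul h𝒜₁ hp hΦ, smul_smul, inv_mul_cancel₀ hA0, one_smul]
  refine ⟨fun y h => h e * (f ((A : X₁ →L[ℂ] X₁) e))⁻¹ * g₁ y, fun g u => f u * g y₁,
    fun y g u h => ?_⟩
  rw [hscal (h𝒜₁.rankOne u h), preserver_smul h𝒜₁ hp hΦ, hP]
  simp only [IsStandardOperatorAlgebra.rankOne, smul_apply, smul_eq_mul,
    ContinuousLinearMap.smulRight_apply, map_smul]
  ring

theorem exists_factorization :
    (∃ (b : X₂ → StrongDual ℂ X₁ → ℂ) (c : StrongDual ℂ X₂ → X₁ → ℂ), ∀ y g u h,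
      g ((Φ (h𝒜₁.rankOne u h) : X₂ →L[ℂ] X₂) y) = b y h * c g u) ∨
    ∃ (b : X₂ → X₁ → ℂ) (c : StrongDual ℂ X₂ → StrongDual ℂ X₁ → ℂ), ∀ y g u h,
      g ((Φ (h𝒜₁.rankOne u h) : X₂ →L[ℂ] X₂) y) = b y u * c g h := by
  let M : X₂ →ₗ[ℂ] StrongDual ℂ X₂ →ₗ[ℂ] X₁ → StrongDual ℂ X₁ → ℂ :=
    LinearMap.mk₂ ℂ (fun y g u h => g ((Φ (h𝒜₁.rankOne u h) : X₂ →L[ℂ] X₂) y))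
      (fun y y' g => by ext; simp) (fun t y g => by ext; simp) (fun y g g' => by ext; simp)
      (fun t y g => by ext; simp)
  obtain ⟨y₁, hy₁⟩ := exists_ne (0 : X₂)
  obtain ⟨g₁, hg₁⟩ := SeparatingDual.exists_eq_one (R := ℂ) hy₁
  obtain ⟨f, x, hf, hx, hfx⟩ := exists_transpose h𝒜₁ hp hΦ y₁ g₁ hg₁
  obtain ⟨h₀, hh₀⟩ := SeparatingDual.exists_eq_one (R := ℂ) hx
  obtain ⟨e, he⟩ : ∃ e, f e = 1 := by
    obtain ⟨u, hu⟩ : ∃ u, f u ≠ 0 := by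
      by_contra! h
      exact hf (ContinuousLinearMap.ext h)
    exact ⟨(f u)⁻¹ • u, by simp [hu]⟩
  have he0 : e ≠ 0 := by
    rintro rfl
    simp at he
  have hM₁ : ∀ u h, M y₁ g₁ u h = f u * h x := by
    intro u h
    change g₁ ((Φ (h𝒜₁.rankOne u h) : X₂ →L[ℂ] X₂) y₁) = _
    rw [hfx]
    simp [IsStandardOperatorAlgebra.rankOne, mul_comm]
  have hM₀ : ∀ u h, (∀ y g, M y g u h = 0) → ∀ v, h v • u = 0 := by
    intro u h h0 v
    have : (Φ (h𝒜₁.rankOne u h) : X₂ →L[ℂ] X₂) = 0 :=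
      eq_of_forall_dual_apply_eq fun y g _ => by
        rw [zero_apply, map_zero]
        exact h0 y g
    have := eq_zero_of_preserver_eq_zero h𝒜₁ hp this
    exact congrArg (fun C : X₁ →L[ℂ] X₁ => C v) this
  rcases bilinear_isPure_cases M (isPure_preserver h𝒜₁ hp hΦ) with
    ⟨a, c, h⟩ | ⟨a, c, h⟩ | h | h
  -- One column a serves all (y, g), so a is proportional to f. Then Φ kills h₀(·)(u - f(u)e), and
  -- injectivity at zero makes X₁ the line through e.
  · refine Or.inl (exists_factorization_of_dim_one h𝒜₁ hp hΦ e f fun u => ?_)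
    have h1 : f e * h₀ x = a e * c y₁ g₁ h₀ := by rw [← hM₁, h]
    have h2 : f (u - f u • e) * h₀ x = a (u - f u • e) * c y₁ g₁ h₀ := by rw [← hM₁, h]
    rw [he, hh₀, one_mul] at h1
    have hc : c y₁ g₁ h₀ ≠ 0 := right_ne_zero_of_mul (h1 ▸ one_ne_zero)
    have ha : a (u - f u • e) = 0 := by simpa [he, hc] using h2
    have h3 := hM₀ (u - f u • e) h₀ (fun y g => by rw [h, ha, zero_mul]) x
    rwa [hh₀, one_smul, sub_eq_zero] at h3
  -- Dually, one row serves all (y, g): a functional j vanishing at x gives Φ(j(·)e) = 0, so none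
  -- can separate u from the line through x.
  · refine Or.inl (exists_factorization_of_dim_one h𝒜₁ hp hΦ x h₀ fun u => ?_)
    by_contra hu
    obtain ⟨j, hj, hju⟩ := exists_dual_eq_zero_eq_one (v := x) (w := u) (by
      rintro t rfl
      exact hu (by simp [hh₀]))
    have h1 : f e * h₀ x = a h₀ * c y₁ g₁ e := by rw [← hM₁, h]
    have h2 : f e * j x = a j * c y₁ g₁ e := by rw [← hM₁, h]
    rw [he, hh₀, one_mul] at h1
    have hc : c y₁ g₁ e ≠ 0 := right_ne_zero_of_mul (h1 ▸ one_ne_zero)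
    have ha : a j = 0 := by simpa [hj, hc] using h2
    have h3 := hM₀ e j (fun y g => by rw [h, ha, zero_mul]) u
    rw [hju, one_smul] at h3
    exact he0 h3
  · exact Or.inl h
  · exact Or.inr h

theorem exists_bilinear_preserver : ∃ R : X₁ →ₗ[ℂ] StrongDual ℂ X₁ →ₗ[ℂ] (X₂ →L[ℂ] X₂),
    ∀ u h, R u h = (Φ (h𝒜₁.rankOne u h) : X₂ →L[ℂ] X₂) := by
  refine ⟨LinearMap.mk₂ ℂ (fun u h => (Φ (h𝒜₁.rankOne u h) : X₂ →L[ℂ] X₂)) ?_ ?_ ?_ ?_,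
    fun u h => rfl⟩
  · intro u u' h
    rw [← preserver_add h𝒜₁ hp hΦ]
    congr 2
    ext v
    simp [IsStandardOperatorAlgebra.rankOne]
  · intro t u h
    rw [← preserver_smul h𝒜₁ hp hΦ]
    congr 2
    ext v
    simp [IsStandardOperatorAlgebra.rankOne, smul_comm t]
  · intro u h h'
    rw [← preserver_add h𝒜₁ hp hΦ]
    congr 2
    ext v
    simp [IsStandardOperatorAlgebra.rankOne, add_smul]
  · intro t u h
    rw [← preserver_smul h𝒜₁ hp hΦ]
    congr 2
    ext v
    simp [IsStandardOperatorAlgebra.rankOne, mul_smul]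

theorem isSpatialIso_of_factorization (b : X₂ → StrongDual ℂ X₁ → ℂ)
    (c : StrongDual ℂ X₂ → X₁ → ℂ)
    (hbc : ∀ y g u h, g ((Φ (h𝒜₁.rankOne u h) : X₂ →L[ℂ] X₂) y) = b y h * c g u) :
    IsSpatialIso (k + 2) Φ := by
  obtain ⟨R, hR⟩ := exists_bilinear_preserver h𝒜₁ hp hΦ
  let p : X₁ →ₗ[ℂ] StrongDual ℂ X₁ →ₗ[ℂ] ℂ := LinearMap.mk₂ ℂ (fun u h => h u)
    (by simp) (by simp) (by simp) (by simp)
  obtain ⟨Q, t, ht, hQ⟩ := exists_equiv_of_factorization (m := k + 2) (by simp) p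
    (fun u hu => SeparatingDual.eq_zero_of_forall_dual_eq_zero (R := ℂ)
      fun h => LinearMap.congr_fun hu h)
    R
    (fun y g hg => by
      obtain ⟨f, x, hf, hx, hfx⟩ := exists_transpose h𝒜₁ hp hΦ y g hg
      refine ⟨f, x, hf, hx, fun u h => ?_⟩
      rw [hR, hfx]
      simp [IsStandardOperatorAlgebra.rankOne, p, mul_comm])
    b c (fun y g u h => by rw [hR, hbc])
    (fun u h χ v hv => preserver_trace_pow h𝒜₁ hp ((hR u h).symm.trans hv))
  refine ⟨t, Q, ht, fun A => ?_⟩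
  -- On idempotents h u = 1 the image has trace t, contributing t^k, and its functional carries one
  -- more t. As t^(k+2) = 1, this inverts to the scalar t.
  have key : (A : X₁ →L[ℂ] X₁) = t ^ (k + 1) •
      ((Q.symm : X₂ →L[ℂ] X₁) ∘L (Φ A : X₂ →L[ℂ] X₂) ∘L (Q : X₁ →L[ℂ] X₂)) := by
    refine eq_of_forall_dual_apply_eq fun u h hu => ?_
    have h1 : (Φ (h𝒜₁.rankOne u h) : X₂ →L[ℂ] X₂) =
        (t • h ∘L (Q.symm : X₂ →L[ℂ] X₁)).smulRight (Q u) := by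
      ext y
      rw [← hR]
      nth_rw 1 [← Q.apply_symm_apply y]
      rw [hQ]
      rfl
    rw [apply_eq_of_preserver_rankOne h𝒜₁ hp hu h1 A]
    simp [hu, pow_succ, mul_assoc]
  rw [key]
  ext y
  simp only [smul_apply, ContinuousLinearMap.comp_apply, ContinuousLinearEquiv.coe_coe, map_smul,
    ContinuousLinearEquiv.apply_symm_apply, smul_smul]
  rw [← pow_succ', ht, one_smul]

theorem isSpatialAntiIso_of_factorization (b : X₂ → X₁ → ℂ)
    (c : StrongDual ℂ X₂ → StrongDual ℂ X₁ → ℂ)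
    (hbc : ∀ y g u h, g ((Φ (h𝒜₁.rankOne u h) : X₂ →L[ℂ] X₂) y) = b y u * c g h) :
    IsSpatialAntiIso (k + 2) Φ := by
  obtain ⟨R, hR⟩ := exists_bilinear_preserver h𝒜₁ hp hΦ
  let p : StrongDual ℂ X₁ →ₗ[ℂ] X₁ →ₗ[ℂ] ℂ := LinearMap.mk₂ ℂ (fun h u => h u)
    (by simp) (by simp) (by simp) (by simp)
  obtain ⟨Q, t, ht, hQ⟩ := exists_equiv_of_factorization (m := k + 2) (by simp) p
    (fun h hh => ContinuousLinearMap.ext fun u => LinearMap.congr_fun hh u) R.flip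
    (fun y g hg => by
      obtain ⟨f, x, hf, hx, hfx⟩ := exists_transpose h𝒜₁ hp hΦ y g hg
      -- The roles of X₁ and its dual are exchanged: evaluation at x is the functional on the dual,
      -- and f is the vector.
      refine ⟨NormedSpace.inclusionInDoubleDual ℂ X₁ x, f, ?_, hf, fun h u => ?_⟩
      · intro h0
        refine hx (SeparatingDual.eq_zero_of_forall_dual_eq_zero (R := ℂ) fun h => ?_)
        rw [← NormedSpace.dual_def, h0, zero_apply]
      · rw [LinearMap.flip_apply, hR, hfx]
        simp [IsStandardOperatorAlgebra.rankOne, p])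
    b c (fun y g h u => by rw [LinearMap.flip_apply, hR, hbc])
    (fun h u χ v hv => preserver_trace_pow h𝒜₁ hp ((hR u h).symm.trans hv))
  refine ⟨t, Q, ht, fun A => ?_⟩
  have key₁ : ∀ (h : StrongDual ℂ X₁) (u : X₁), h u = 1 → h ((A : X₁ →L[ℂ] X₁) u) =
      t ^ (k + 1) * Q.symm ((Φ A : X₂ →L[ℂ] X₂) (Q h)) u := by
    intro h u hu
    have h1 : (Φ (h𝒜₁.rankOne u h) : X₂ →L[ℂ] X₂) =
        (t • NormedSpace.inclusionInDoubleDual ℂ X₁ u ∘L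
          (Q.symm : X₂ →L[ℂ] StrongDual ℂ X₁)).smulRight (Q h) := by
      ext y
      rw [← hR]
      nth_rw 1 [← Q.apply_symm_apply y]
      rw [← LinearMap.flip_apply, hQ]
      rfl
    rw [apply_eq_of_preserver_rankOne h𝒜₁ hp hu h1 A]
    simp [hu, pow_succ, mul_assoc]
  have key : banachAdjoint (A : X₁ →L[ℂ] X₁) = t ^ (k + 1) •
      ((Q.symm : X₂ →L[ℂ] StrongDual ℂ X₁) ∘L (Φ A : X₂ →L[ℂ] X₂) ∘L
        (Q : StrongDual ℂ X₁ →L[ℂ] X₂)) := by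
    ext h u
    change h ((A : X₁ →L[ℂ] X₁) u) = t ^ (k + 1) * Q.symm ((Φ A : X₂ →L[ℂ] X₂) (Q h)) u
    by_cases hh : ∃ u₀, h u₀ ≠ 0
    · have key₂ : ∀ u, h u ≠ 0 → h ((A : X₁ →L[ℂ] X₁) u) =
          t ^ (k + 1) * Q.symm ((Φ A : X₂ →L[ℂ] X₂) (Q h)) u := by
        intro u hu
        have h1 := key₁ h ((h u)⁻¹ • u) (by simp [hu])
        simp only [map_smul, smul_eq_mul] at h1
        rw [mul_left_comm] at h1
        exact mul_left_cancel₀ (inv_ne_zero hu) h1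
      obtain ⟨u₀, hu₀⟩ := hh
      by_cases hu : h u = 0
      · have h1 := key₂ (u + u₀) (by simpa [hu] using hu₀)
        have h2 := key₂ u₀ hu₀
        simp only [map_add] at h1
        linear_combination h1 - h2
      · exact key₂ u hu
    · push Not at hh
      have : h = 0 := ContinuousLinearMap.ext hh
      simp [this]
  rw [key]
  ext y
  simp only [smul_apply, ContinuousLinearMap.comp_apply, ContinuousLinearEquiv.coe_coe, map_smul,
    ContinuousLinearEquiv.apply_symm_apply, smul_smul]
  rw [← pow_succ', ht, one_smul]

theorem isSpatialIso_or_isSpatialAntiIso :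
    IsSpatialIso (k + 2) Φ ∨ IsSpatialAntiIso (k + 2) Φ := by
  rcases exists_factorization h𝒜₁ hp hΦ with ⟨b, c, h⟩ | ⟨b, c, h⟩
  · exact Or.inl (isSpatialIso_of_factorization h𝒜₁ hp hΦ b c h)
  · exact Or.inr (isSpatialAntiIso_of_factorization h𝒜₁ hp hΦ b c h)

end Preserver

/-! ### Adjoints, reflexivity and the converse. -/

section Converse

variable {X X₁ X₂ : Type*} [NormedAddCommGroup X] [NormedSpace ℂ X]
  [NormedAddCommGroup X₁] [NormedSpace ℂ X₁] [NormedAddCommGroup X₂] [NormedSpace ℂ X₂]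
  {𝒜₁ : NonUnitalSubalgebra ℂ (X₁ →L[ℂ] X₁)} {𝒜₂ : NonUnitalSubalgebra ℂ (X₂ →L[ℂ] X₂)}
  {Φ : 𝒜₁ → 𝒜₂}

theorem banachAdjoint_apply (A : X →L[ℂ] X) (h : StrongDual ℂ X) (x : X) :
    banachAdjoint A h x = h (A x) := rfl

theorem banachAdjoint_mul (A B : X →L[ℂ] X) :
    banachAdjoint (A * B) = banachAdjoint B * banachAdjoint A := rfl

set_option synthInstance.maxHeartbeats 200000 in
theorem banachAdjoint_pow (A : X →L[ℂ] X) (n : ℕ) :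
    banachAdjoint (A ^ n) = banachAdjoint A ^ n := by
  induction n with
  | zero => rfl
  | succ n ih => rw [pow_succ, pow_succ', banachAdjoint_mul, ih]

theorem banachAdjoint_injective : Function.Injective (banachAdjoint (X := X)) := by
  intro A B h
  ext x
  rw [SeparatingDual.eq_iff_forall_dual_eq (R := ℂ)]
  intro g
  rw [← banachAdjoint_apply, h, banachAdjoint_apply]

/-- On a reflexive space every operator on the dual is an adjoint. -/
theorem IsReflexiveSpace.banachAdjoint_surjective (hX : IsReflexiveSpace X) :
    Function.Surjective (banachAdjoint (X := X)) := by
  intro C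
  let J : X ≃ₗᵢ[ℂ] StrongDual ℂ (StrongDual ℂ X) :=
    LinearIsometryEquiv.ofSurjective (NormedSpace.inclusionInDoubleDualLi ℂ) hX
  have hJ : ∀ x h, J x h = h x := fun x h => rfl
  refine ⟨(J.symm.toContinuousLinearEquiv : _ →L[ℂ] X) ∘L banachAdjoint C ∘L
    (J.toContinuousLinearEquiv : X →L[ℂ] _), ?_⟩
  ext h x
  rw [banachAdjoint_apply, ← hJ]
  change J (J.symm (banachAdjoint C (J x))) h = _
  rw [J.apply_symm_apply, banachAdjoint_apply, hJ]

set_option synthInstance.maxHeartbeats 200000 in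
theorem IsReflexiveSpace.spectrum_banachAdjoint (hX : IsReflexiveSpace X) (A : X →L[ℂ] X) :
    spectrum ℂ (banachAdjoint A) = spectrum ℂ A := by
  have hunit : ∀ B : X →L[ℂ] X, IsUnit (banachAdjoint B) ↔ IsUnit B := by
    intro B
    simp only [isUnit_iff_exists]
    constructor
    · rintro ⟨C, h1, h2⟩
      obtain ⟨D, rfl⟩ := hX.banachAdjoint_surjective C
      exact ⟨D, banachAdjoint_injective h2, banachAdjoint_injective h1⟩
    · rintro ⟨D, h1, h2⟩
      refine ⟨banachAdjoint D, ?_, ?_⟩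
      · rw [← banachAdjoint_mul, h2]; rfl
      · rw [← banachAdjoint_mul, h1]; rfl
  ext z
  rw [spectrum.mem_iff, spectrum.mem_iff, ← hunit]
  suffices h : banachAdjoint (algebraMap ℂ (X →L[ℂ] X) z - A) =
      algebraMap ℂ _ z - banachAdjoint A by rw [h]
  ext h x
  simp [banachAdjoint_apply, Algebra.algebraMap_eq_smul_one]

/-- Some A has t A* equal to the rank-one operator φ(·)f. Evaluating at x with f x = 1 gives φ(h) =
h(t A x), so t A x represents φ. -/
theorem IsSpatialAntiIso.isReflexiveSpace_left {m : ℕ} (hm : m ≠ 0)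
    (hΦ : ∀ (g : StrongDual ℂ X₂) (y : X₂), ∃ A : 𝒜₁, (Φ A : X₂ →L[ℂ] X₂) = g.smulRight y)
    (h : IsSpatialAntiIso m Φ) : IsReflexiveSpace X₁ := by
  obtain ⟨t, T, ht, hT⟩ := h
  have ht0 : t ≠ 0 := by
    rintro rfl
    simp [hm] at ht
  intro φ
  rcases subsingleton_or_nontrivial X₁ with hX | hX
  · refine ⟨0, ?_⟩
    ext h
    have : h = 0 := ContinuousLinearMap.ext fun x => by simp [Subsingleton.elim x 0]
    simp [this]
  obtain ⟨x, hx⟩ := exists_ne (0 : X₁)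
  obtain ⟨f, hf⟩ := SeparatingDual.exists_eq_one (R := ℂ) hx
  obtain ⟨A, hA⟩ := hΦ (φ ∘L (T.symm : X₂ →L[ℂ] StrongDual ℂ X₁)) (T f)
  refine ⟨t • (A : X₁ →L[ℂ] X₁) x, ?_⟩
  ext h
  have h1 := congrArg (fun C : X₂ →L[ℂ] X₂ => T.symm (C (T h)) x) ((hT A).symm.trans hA)
  simp only [smul_apply, ContinuousLinearMap.comp_apply, ContinuousLinearEquiv.coe_coe, map_smul,
    ContinuousLinearEquiv.symm_apply_apply, ContinuousLinearMap.smulRight_apply,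
    banachAdjoint_apply, hf, smul_eq_mul, mul_one] at h1
  rw [NormedSpace.dual_def, map_smul, smul_eq_mul, h1]

theorem IsReflexiveSpace.of_dual_equiv (hX : IsReflexiveSpace X₁) (T : StrongDual ℂ X₁ ≃L[ℂ] X₂) :
    IsReflexiveSpace X₂ := by
  intro φ
  -- φ transported along the adjoint of T⁻¹ and restricted to X₁; reflexivity of X₁ makes this
  -- restriction lose nothing.
  let h : StrongDual ℂ X₁ := φ ∘L
    (ContinuousLinearMap.precomp ℂ (T.symm : X₂ →L[ℂ] StrongDual ℂ X₁)) ∘L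
      NormedSpace.inclusionInDoubleDual ℂ X₁
  refine ⟨T h, ?_⟩
  ext g
  obtain ⟨u, hu⟩ := hX (g ∘L (T : StrongDual ℂ X₁ →L[ℂ] X₂))
  have h1 : g (T h) = h u := by
    rw [← NormedSpace.dual_def ℂ X₁ u h, hu]
    rfl
  rw [NormedSpace.dual_def, h1]
  change φ (NormedSpace.inclusionInDoubleDual ℂ X₁ u ∘L
    (T.symm : X₂ →L[ℂ] StrongDual ℂ X₁)) = φ g
  rw [hu]
  congr 1
  ext y
  simp

theorem peripheralSpectrum_conj (T : X₁ ≃L[ℂ] X₂) (A : X₁ →L[ℂ] X₁) :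
    peripheralSpectrum (T.conjContinuousAlgEquiv A) = peripheralSpectrum A :=
  peripheralSpectrum_congr (AlgEquiv.spectrum_eq T.conjContinuousAlgEquiv A)

theorem smul_pow_mul_mul_pow {R : Type*} [Ring R] [Algebra ℂ R] {t : ℂ} {r s : ℕ}
    (ht : t ^ (r + s + 1) = 1) (a b : R) :
    (t • b) ^ r * (t • a) * (t • b) ^ s = b ^ r * a * b ^ s := by
  simp only [smul_pow, smul_mul_assoc, mul_smul_comm, smul_smul]
  rw [show t ^ s * (t * t ^ r) = 1 by rw [← ht]; ring, one_smul]

theorem IsSpatialIso.peripheralSpectrum_eq {r s : ℕ} (h : IsSpatialIso (r + s + 1) Φ)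
    (A B : 𝒜₁) :
    peripheralSpectrum ((B : X₁ →L[ℂ] X₁) ^ r * (A : X₁ →L[ℂ] X₁) * (B : X₁ →L[ℂ] X₁) ^ s) =
      peripheralSpectrum
        ((Φ B : X₂ →L[ℂ] X₂) ^ r * (Φ A : X₂ →L[ℂ] X₂) * (Φ B : X₂ →L[ℂ] X₂) ^ s) := by
  obtain ⟨t, T, ht, hT⟩ := h
  have hT' : ∀ A : 𝒜₁, (Φ A : X₂ →L[ℂ] X₂) = t • T.conjContinuousAlgEquiv (A : X₁ →L[ℂ] X₁) := hT
  rw [hT', hT', smul_pow_mul_mul_pow ht, ← map_pow, ← map_pow, ← map_mul, ← map_mul,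
    peripheralSpectrum_conj]

theorem IsSpatialAntiIso.peripheralSpectrum_eq [CompleteSpace X₁] {r s : ℕ}
    (hX : IsReflexiveSpace X₁) (h : IsSpatialAntiIso (r + s + 1) Φ) (A B : 𝒜₁) :
    peripheralSpectrum ((B : X₁ →L[ℂ] X₁) ^ r * (A : X₁ →L[ℂ] X₁) * (B : X₁ →L[ℂ] X₁) ^ s) =
      peripheralSpectrum
        ((Φ B : X₂ →L[ℂ] X₂) ^ r * (Φ A : X₂ →L[ℂ] X₂) * (Φ B : X₂ →L[ℂ] X₂) ^ s) := by
  obtain ⟨t, T, ht, hT⟩ := h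
  have hT' : ∀ A : 𝒜₁, (Φ A : X₂ →L[ℂ] X₂) =
      t • T.conjContinuousAlgEquiv (banachAdjoint (A : X₁ →L[ℂ] X₁)) := hT
  -- Adjoints reverse products and swap r with s, which cyclic invariance absorbs.
  rw [hT', hT', smul_pow_mul_mul_pow ht, ← map_pow, ← map_pow, ← map_mul, ← map_mul,
    peripheralSpectrum_conj, ← banachAdjoint_pow, ← banachAdjoint_pow, mul_assoc,
    ← banachAdjoint_mul, ← banachAdjoint_mul,
    peripheralSpectrum_congr (hX.spectrum_banachAdjoint _),
    ← mul_assoc, peripheralSpectrum_pow_mul_mul_pow, ← mul_assoc,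
    peripheralSpectrum_pow_mul_mul_pow, add_comm]

end Converse

theorem peripheralSpectrum_zero_nonempty {X : Type*} [NormedAddCommGroup X] [NormedSpace ℂ X]
    [Nontrivial X] [CompleteSpace X] : (peripheralSpectrum (0 : X →L[ℂ] X)).Nonempty := by
  have h : (0 : X →L[ℂ] X) = (0 : StrongDual ℂ X).smulRight 0 := by ext; simp
  rw [h, peripheralSpectrum_smulRight]
  exact Set.singleton_nonempty _

theorem peripheralSpectrum_of_subsingleton {X : Type*} [NormedAddCommGroup X] [NormedSpace ℂ X]
    [Subsingleton X] (A : X →L[ℂ] X) : peripheralSpectrum A = ∅ := by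
  have : Subsingleton (X →L[ℂ] X) :=
    ⟨fun _ _ => ContinuousLinearMap.ext fun _ => Subsingleton.elim _ _⟩
  simp [peripheralSpectrum, spectrum.of_subsingleton]

end PeripheralPreserver

theorem theorem2p2 {X₁ X₂ : Type*}
    [NormedAddCommGroup X₁] [NormedSpace ℂ X₁] [CompleteSpace X₁]
    [NormedAddCommGroup X₂] [NormedSpace ℂ X₂] [CompleteSpace X₂]
    (𝒜₁ : NonUnitalSubalgebra ℂ (X₁ →L[ℂ] X₁)) (𝒜₂ : NonUnitalSubalgebra ℂ (X₂ →L[ℂ] X₂))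
    (h𝒜₁ : PeripheralPreserver.IsStandardOperatorAlgebra 𝒜₁)
    (h𝒜₂ : PeripheralPreserver.IsStandardOperatorAlgebra 𝒜₂)
    (Φ : 𝒜₁ → 𝒜₂)
    (hΦ : ∀ C : X₂ →L[ℂ] X₂, LinearMap.rank (C : X₂ →ₗ[ℂ] X₂) ≤ 2 →
      ∃ A : 𝒜₁, (Φ A : X₂ →L[ℂ] X₂) = C)
    (r s : ℕ) (hrs : 1 ≤ r + s) :
    ((∀ A B : 𝒜₁,
        PeripheralPreserver.peripheralSpectrum
            ((B : X₁ →L[ℂ] X₁) ^ r * (A : X₁ →L[ℂ] X₁) * (B : X₁ →L[ℂ] X₁) ^ s) =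
          PeripheralPreserver.peripheralSpectrum
            ((Φ B : X₂ →L[ℂ] X₂) ^ r * (Φ A : X₂ →L[ℂ] X₂) * (Φ B : X₂ →L[ℂ] X₂) ^ s)) ↔
      (PeripheralPreserver.IsSpatialIso (r + s + 1) Φ ∨
        PeripheralPreserver.IsSpatialAntiIso (r + s + 1) Φ)) ∧
    (PeripheralPreserver.IsSpatialAntiIso (r + s + 1) Φ →
      PeripheralPreserver.IsReflexiveSpace X₁ ∧ PeripheralPreserver.IsReflexiveSpace X₂) := by
  have hΦ' : ∀ (g : StrongDual ℂ X₂) (y : X₂), ∃ A : 𝒜₁,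
      (Φ A : X₂ →L[ℂ] X₂) = g.smulRight y := fun g y =>
    hΦ _ ((PeripheralPreserver.rank_smulRight_le_one g y).trans one_le_two)
  refine ⟨⟨fun hp => ?_, ?_⟩, fun h => ?_⟩
  -- The rank-one computation needs nonempty spectra. If X₁ = 0, the domain of Φ is one point, so
  -- its range forces X₂ = 0; if only X₂ = 0, the peripheral spectra at A = B = 0 differ.
  · rcases subsingleton_or_nontrivial X₁ with hX₁ | hX₁
    · have hX₂ : Subsingleton X₂ := by
        rw [← not_nontrivial_iff_subsingleton]
        intro hX₂
        obtain ⟨y, hy⟩ := exists_ne (0 : X₂)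
        obtain ⟨g, hg⟩ := SeparatingDual.exists_eq_one (R := ℂ) hy
        obtain ⟨A, hA⟩ := hΦ' g y
        obtain ⟨B, hB⟩ := hΦ' 0 y
        have hAB : A = B :=
          Subtype.ext (ContinuousLinearMap.ext fun x => Subsingleton.elim _ _)
        rw [hAB, hB] at hA
        have := congrArg (fun C : X₂ →L[ℂ] X₂ => g (C y)) hA
        simp [hg] at this
      refine Or.inl ⟨1, ⟨⟨0, 0, fun x => Subsingleton.elim _ _, fun x => Subsingleton.elim _ _⟩,
        continuous_const, continuous_const⟩, one_pow _, fun A => ?_⟩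
      exact ContinuousLinearMap.ext fun x => Subsingleton.elim _ _
    · have hX₂ : Nontrivial X₂ := by
        rw [← not_subsingleton_iff_nontrivial]
        intro hX₂
        have h0 := hp 0 0
        rw [ZeroMemClass.coe_zero, mul_zero, zero_mul,
          PeripheralPreserver.peripheralSpectrum_of_subsingleton (X := X₂)] at h0
        exact PeripheralPreserver.peripheralSpectrum_zero_nonempty.ne_empty h0
      obtain ⟨k, hk⟩ : ∃ k, r + s = k + 1 := ⟨r + s - 1, by omega⟩
      rw [hk]
      refine PeripheralPreserver.isSpatialIso_or_isSpatialAntiIso h𝒜₁ (fun A B => ?_) hΦ'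
      have := hp A B
      rwa [PeripheralPreserver.peripheralSpectrum_pow_mul_mul_pow,
        PeripheralPreserver.peripheralSpectrum_pow_mul_mul_pow, hk] at this
  · rintro (h | h)
    · exact h.peripheralSpectrum_eq
    · exact h.peripheralSpectrum_eq (h.isReflexiveSpace_left (Nat.succ_ne_zero _) hΦ')
  · have hX₁ := h.isReflexiveSpace_left (Nat.succ_ne_zero _) hΦ'
    obtain ⟨-, T, -⟩ := h
    exact ⟨hX₁, hX₁.of_dual_equiv T⟩
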